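/- Let $n_1,n_2\ge 0$, let $\mathcal{K}^1\subseteq\mathbb{R}^{n_1}$ and $\mathcal{K}^2\subseteq\mathbb{R}^{n_2}$ be nonempty closed convex cones such that $\mathcal{K}^2$ is polyhedral (i.e. a finite intersection of half-spaces $\{x : \langle a,x\rangle\ge 0\}$), let $\mathcal{K}=\mathcal{K}^1\times\mathcal{K}^2$, and let $\mathcal{L}\subseteq\mathbb{R}^{n_1}\times\mathbb{R}^{n_2}$ be a linear subspace. Then $$\mathcal{K}^*\cap\mathcal{L}^\perp\subseteq \mathrm{lin}\bigl((\mathcal{K}^1)^*\bigr)\times(\mathcal{K}^2)^*\quad\Longleftrightarrow\quad \bigl((\mathrm{ri}\,\mathcal{K}^1)\times\mathcal{K}^2\bigr)\cap\mathcal{L}\neq\emptyset .$$ Here $C^*=\{y : \langle x,y\rangle\ge 0 \text{ for all } x\in C\}$ is the dual cone, $\mathrm{lin}\,C=C\cap(-C)$ is the lineality space, $\mathrm{ri}\,C$ is the relative interior (the interior of $C$ in its affine hull), $\mathcal{L}^\perp$ is the orthogonal complement, and all inner products are the standard Euclidean ones, with $\langle (x_1,x_2),(y_1,y_2)\rangle=\langle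 x_1,y_1\rangle+\langle x_2,y_2\rangle$ on the product. -/

import Mathlib

open scoped RealInnerProductSpace

namespace PartialPolyhedral

/-- The Cartesian product `S × T`, as a subset of the Euclidean (`ℓ²`) product of two Euclidean
spaces, whose inner product is `⟪(x₁, x₂), (y₁, y₂)⟫ = ⟪x₁, y₁⟫ + ⟪x₂, y₂⟫`. -/
def euclideanProd {n₁ n₂ : ℕ} (S : Set (EuclideanSpace ℝ (Fin n₁)))
    (T : Set (EuclideanSpace ℝ (Fin n₂))) :
    Set (WithLp 2 (EuclideanSpace ℝ (Fin n₁) × EuclideanSpace ℝ (Fin n₂))) :=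
  {x | x.fst ∈ S ∧ x.snd ∈ T}

/-- A closed convex cone is polyhedral if it is the solution set of a finite (possibly empty)
system of homogeneous linear inequalities, i.e. a finite intersection of linear half-spaces. -/
def IsPolyhedral {n : ℕ} (C : ProperCone ℝ (EuclideanSpace ℝ (Fin n))) : Prop :=
  ∃ A : Finset (EuclideanSpace ℝ (Fin n)), ∀ x, x ∈ C ↔ ∀ a ∈ A, 0 ≤ ⟪a, x⟫

end PartialPolyhedral

namespace PartialPolyhedral

/-! For `→`, suppose the projection `M` of `L ∩ (E × K₂)` to the first factor misses `ri K₁`.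
Separating inside `span K₁` gives `y`, nonnegative and not identically zero on `K₁`, nonpositive on
`M ∩ span K₁`. As `K₂` is polyhedral, Farkas' lemma completes `y` to a vector of `Lᗮ` with second
part in `K₂*`, changing `y` only orthogonally to `span K₁`. Its first part lies in `K₁*` but not in
the lineality space. For `←`, orthogonality forces both nonnegative pairings to vanish, and a point
of `ri K₁` can be pushed away from any `z ∈ K₁`. -/

/-- **Farkas' lemma**: a linear functional that is nonnegative on the solution set of a finite
system of homogeneous linear inequalities is a nonnegative combination of the constraints. -/
theorem exists_nonneg_sum_of_forall_nonneg {ι V : Type*} [AddCommGroup V] [Module ℝ V]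
    (s : Finset ι) (a : ι → V →ₗ[ℝ] ℝ) (f : V →ₗ[ℝ] ℝ)
    (h : ∀ x, (∀ i ∈ s, 0 ≤ a i x) → 0 ≤ f x) :
    ∃ c : ι → ℝ, (∀ i, 0 ≤ c i) ∧ f = ∑ i ∈ s, c i • a i := by
  classical
  induction s using Finset.induction_on generalizing a f with
  | empty =>
    refine ⟨0, fun _ => le_rfl, LinearMap.ext fun x => ?_⟩
    have h₁ := h x (by simp)
    have h₂ := h (-x) (by simp)
    rw [map_neg] at h₂
    simp only [Finset.sum_empty, LinearMap.zero_apply]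
    linarith
  | insert j s hj ih =>
    by_cases hf : ∀ x, (∀ i ∈ s, 0 ≤ a i x) → 0 ≤ f x
    · obtain ⟨c, hc, rfl⟩ := ih a f hf
      refine ⟨Function.update c j 0, fun i => ?_, ?_⟩
      · rcases eq_or_ne i j with rfl | hij
        · simp
        · simpa [hij] using hc i
      · rw [Finset.sum_insert hj, Function.update_self, zero_smul, zero_add]
        refine Finset.sum_congr rfl fun i hi => ?_
        rw [Function.update_of_ne (ne_of_mem_of_not_mem hi hj)]
    · push Not at hf
      obtain ⟨x₀, hx₀, hfx₀⟩ := hf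
      have hjx₀ : a j x₀ < 0 := by
        by_contra! hjx
        exact hfx₀.not_ge (h x₀ (Finset.forall_mem_insert _ _ _ |>.2 ⟨hjx, hx₀⟩))
      set r : ℝ := -(a j x₀)⁻¹ with hr
      have hr₀ : 0 < r := neg_pos.2 (inv_lt_zero.2 hjx₀)
      have hr₁ : r * a j x₀ = -1 := by
        rw [hr, neg_mul, inv_mul_cancel₀ hjx₀.ne]
      -- Compose everything with the projection `x ↦ x + r * a j x • x₀` onto `ker (a j)` along
      -- `x₀`; there constraint `j` holds trivially.
      obtain ⟨c, hc, hfc⟩ := ih (fun i => a i + (r * a i x₀) • a j) (f + (r * f x₀) • a j)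
        (fun x hx => by
          have hz := h (x + (r * a j x) • x₀) (Finset.forall_mem_insert _ _ _ |>.2
            ⟨by
              have : a j x + r * a j x * a j x₀ = 0 := by linear_combination a j x * hr₁
              simp [this], fun i hi => by
              have := hx i hi
              simp only [LinearMap.add_apply, LinearMap.smul_apply, smul_eq_mul] at this
              simp only [map_add, map_smul, smul_eq_mul]
              linarith⟩)
          simp only [map_add, map_smul, smul_eq_mul] at hz
          simp only [LinearMap.add_apply, LinearMap.smul_apply, smul_eq_mul]
          linarith)
      -- The coefficient of `a j` after solving `hfc` for `f`.
      set d : ℝ := ∑ i ∈ s, c i * (r * a i x₀) - r * f x₀ with hd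
      have hd₀ : 0 ≤ d := by
        have h₁ : 0 ≤ ∑ i ∈ s, c i * (r * a i x₀) := Finset.sum_nonneg fun i hi =>
          mul_nonneg (hc i) (mul_nonneg hr₀.le (hx₀ i hi))
        have h₂ : r * f x₀ < 0 := mul_neg_of_pos_of_neg hr₀ hfx₀
        linarith
      refine ⟨Function.update c j d, fun i => ?_, ?_⟩
      · rcases eq_or_ne i j with rfl | hij
        · simpa using hd₀
        · simpa [hij] using hc i
      · have hsum : ∑ i ∈ s, Function.update c j d i • a i = ∑ i ∈ s, c i • a i :=
          Finset.sum_congr rfl fun i hi => by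
            rw [Function.update_of_ne (ne_of_mem_of_not_mem hi hj)]
        rw [Finset.sum_insert hj, Function.update_self, hsum, eq_sub_of_add_eq hfc, hd]
        simp only [smul_add, Finset.sum_add_distrib, smul_smul, ← Finset.sum_smul]
        module

section IntrinsicInterior

variable {E : Type*} [NormedAddCommGroup E] [NormedSpace ℝ E]

/-- The intrinsic interior of a set containing the origin is its interior in its linear span. -/
theorem intrinsicInterior_eq_image_interior_span {s : Set E} (h₀ : (0 : E) ∈ s) :
    intrinsicInterior ℝ s =
      (↑) '' interior ((↑) ⁻¹' s : Set (Submodule.span ℝ s)) := by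
  -- Quantifying over `A` lets `rfl` handle the dependence of the subtype on the affine span.
  have key : ∀ A : AffineSubspace ℝ E, A = (Submodule.span ℝ s).toAffineSubspace →
      ((↑) '' interior ((↑) ⁻¹' s : Set A) : Set E) =
        (↑) '' interior ((↑) ⁻¹' s : Set (Submodule.span ℝ s)) := by
    rintro _ rfl
    rfl
  refine key _ ?_
  apply SetLike.coe_injective
  change (affineSpan ℝ s : Set E) = Submodule.span ℝ s
  rw [← affineSpan_insert_zero, Set.insert_eq_of_mem h₀]

/-- From a point of the intrinsic interior one can move a little in the direction opposite to any
point of the set. -/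
theorem exists_pos_sub_smul_mem_of_mem_intrinsicInterior {s : Set E} (h₀ : (0 : E) ∈ s) {x z : E}
    (hx : x ∈ intrinsicInterior ℝ s) (hz : z ∈ s) : ∃ t : ℝ, 0 < t ∧ x - t • z ∈ s := by
  rw [intrinsicInterior_eq_image_interior_span h₀] at hx
  obtain ⟨x, hx, rfl⟩ := hx
  have hcont : Filter.Tendsto
      (fun t : ℝ => x - t • (⟨z, Submodule.subset_span hz⟩ : Submodule.span ℝ s))
      (nhds 0) (nhds x) := by
    have : Continuous
        (fun t : ℝ => x - t • (⟨z, Submodule.subset_span hz⟩ : Submodule.span ℝ s)) := by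
      fun_prop
    simpa using this.tendsto 0
  have hev := hcont.eventually (mem_interior_iff_mem_nhds.1 hx)
  obtain ⟨t, ht, ht₀⟩ :=
    ((hev.filter_mono nhdsWithin_le_nhds).and (self_mem_nhdsWithin (s := Set.Ioi (0 : ℝ)))).exists
  exact ⟨t, ht₀, ht⟩

end IntrinsicInterior

section Separation

variable {E : Type*} [NormedAddCommGroup E] [InnerProductSpace ℝ E] [FiniteDimensional ℝ E]

/-- A convex cone that misses the relative interior of a closed convex cone `K` is separated from
`K`, within the span of `K`, by a vector that does not vanish on `K`. -/
theorem exists_inner_separation_of_disjoint_intrinsicInterior (K : ProperCone ℝ E)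
    (M : PointedCone ℝ E) (h : Disjoint (intrinsicInterior ℝ (K : Set E)) M) :
    ∃ y : E, (∀ x ∈ K, 0 ≤ ⟪x, y⟫) ∧ (∃ x ∈ K, ⟪x, y⟫ ≠ 0) ∧
      ∀ x ∈ M, x ∈ Submodule.span ℝ (K : Set E) → ⟪x, y⟫ ≤ 0 := by
  have h₀ : (0 : E) ∈ (K : Set E) := zero_mem K
  have hK : Convex ℝ (K : Set E) := K.toPointedCone.convex
  set S : Set (Submodule.span ℝ (K : Set E)) := (↑) ⁻¹' (K : Set E)
  set T : Set (Submodule.span ℝ (K : Set E)) := (↑) ⁻¹' (M : Set E)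
  have hSc : Convex ℝ S := hK.linear_preimage (Submodule.subtype _)
  have hTc : Convex ℝ T := M.convex.linear_preimage (Submodule.subtype _)
  have hri := intrinsicInterior_eq_image_interior_span h₀
  obtain ⟨_, hp⟩ := Set.Nonempty.intrinsicInterior hK ⟨0, h₀⟩
  rw [hri] at hp
  obtain ⟨p, hp, rfl⟩ := hp
  have hdisj : Disjoint (interior S) T := Set.disjoint_left.2 fun x hx hxT =>
    Set.disjoint_left.1 h (hri ▸ Set.mem_image_of_mem _ hx) hxT
  obtain ⟨f, u, hfS, hfT⟩ := geometric_hahn_banach_open hSc.interior isOpen_interior hTc hdisj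
  have hu : u ≤ 0 := by simpa using hfT 0 (show (0 : E) ∈ M from zero_mem M)
  have hfT' : ∀ x ∈ T, 0 ≤ f x := by
    intro x hx
    by_contra! hfx
    -- Rescaled so that `f` takes the value `u - 1`, below the bound `u`.
    have hmem : (((u - 1) / f x) • x : Submodule.span ℝ (K : Set E)) ∈ T :=
      M.smul_mem (div_nonneg_of_nonpos (by linarith) hfx.le) hx
    have := hfT _ hmem
    rw [map_smul, smul_eq_mul, div_mul_cancel₀ _ hfx.ne] at this
    linarith
  have hfS' : ∀ x ∈ S, f x ≤ 0 := by
    intro x hx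
    have hx' : x ∈ closure (interior S) := by
      rw [hSc.closure_interior_eq_closure_of_nonempty_interior ⟨p, hp⟩]
      exact subset_closure hx
    exact closure_minimal (fun z hz => (hfS z hz).le.trans hu)
      (isClosed_le f.continuous continuous_const) hx'
  set w := (InnerProductSpace.toDual ℝ (Submodule.span ℝ (K : Set E))).symm f with hw
  have hfw : ∀ x : Submodule.span ℝ (K : Set E), ⟪(x : E), -(w : E)⟫ = -f x := by
    intro x
    rw [inner_neg_right, real_inner_comm, ← Submodule.coe_inner, hw,
      InnerProductSpace.toDual_symm_apply]
  refine ⟨-(w : E), fun x hx => ?_, ⟨p, interior_subset (s := S) hp, ?_⟩, fun x hxM hx => ?_⟩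
  · have := hfw ⟨x, Submodule.subset_span hx⟩
    have := hfS' ⟨x, Submodule.subset_span hx⟩ hx
    linarith
  -- The separation is strict on the open set `interior S`, so `f p < u ≤ 0`.
  · rw [hfw p]
    have := hfS p hp
    linarith
  · have := hfw ⟨x, hx⟩
    have := hfT' ⟨x, hx⟩ hxM
    linarith

end Separation

section Product

variable {E F : Type*} [NormedAddCommGroup E] [InnerProductSpace ℝ E]
  [NormedAddCommGroup F] [InnerProductSpace ℝ F]

/-- The vectors orthogonal to a full cylinder over a subspace `U` of the first factor. -/
theorem mem_orthogonal_comap_fst {U : Submodule ℝ E} {w : WithLp 2 (E × F)}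
    (hw : w ∈ (U.comap (WithLp.fstL 2 ℝ E F).toLinearMap)ᗮ) : w.fst ∈ Uᗮ ∧ w.snd = 0 := by
  rw [Submodule.mem_orthogonal] at hw
  constructor
  · rw [Submodule.mem_orthogonal]
    intro u hu
    simpa [WithLp.prod_inner_apply] using hw (WithLp.toLp 2 (u, 0)) hu
  · have := hw (WithLp.toLp 2 (0, w.snd)) (zero_mem U)
    simpa [WithLp.prod_inner_apply] using this

variable [FiniteDimensional ℝ E] [FiniteDimensional ℝ F]

/-- If `⟪·, y⟫` is nonpositive at the first component of every point of `L` whose first component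
lies in `U` and whose second component satisfies the inequalities `0 ≤ ⟪a, ·⟫`, `a ∈ A`, then `y`
can be changed by a vector orthogonal to `U` and completed by a nonnegative combination of `A`
to a vector orthogonal to `L`. -/
theorem exists_mem_orthogonal_of_inner_nonpos (A : Finset F) (U : Submodule ℝ E)
    (L : Submodule ℝ (WithLp 2 (E × F))) (y : E)
    (h : ∀ x ∈ L, x.fst ∈ U → (∀ a ∈ A, 0 ≤ ⟪a, x.snd⟫) → ⟪x.fst, y⟫ ≤ 0) :
    ∃ z ∈ Lᗮ, (∀ x ∈ U, ⟪x, z.fst⟫ = ⟪x, y⟫) ∧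
      ∀ v, (∀ a ∈ A, 0 ≤ ⟪a, v⟫) → 0 ≤ ⟪v, z.snd⟫ := by
  set C := U.comap (WithLp.fstL 2 ℝ E F).toLinearMap
  obtain ⟨c, hc, hsum⟩ := exists_nonneg_sum_of_forall_nonneg A
    (fun a => (innerₗ F a) ∘ₗ (WithLp.sndL 2 ℝ E F).toLinearMap ∘ₗ (L ⊓ C).subtype)
    (-((innerₗ E y) ∘ₗ (WithLp.fstL 2 ℝ E F).toLinearMap ∘ₗ (L ⊓ C).subtype))
    (fun x hx => by
      have := h x x.2.1 x.2.2 hx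
      rw [real_inner_comm] at this
      simpa using this)
  set b : F := ∑ a ∈ A, c a • a with hb
  have hmem : WithLp.toLp 2 (y, b) ∈ (L ⊓ C)ᗮ := by
    rw [Submodule.mem_orthogonal']
    intro x hx
    have := LinearMap.congr_fun hsum ⟨x, hx⟩
    simp only [LinearMap.neg_apply, LinearMap.sum_apply, LinearMap.smul_apply,
      LinearMap.comp_apply, innerₗ_apply_apply, Submodule.subtype_apply, smul_eq_mul] at this
    rw [WithLp.prod_inner_apply, hb]
    simp only [sum_inner, real_inner_smul_left]
    change -⟪y, x.fst⟫ = ∑ a ∈ A, c a * ⟪a, x.snd⟫ at this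
    change ⟪y, x.fst⟫ + ∑ a ∈ A, c a * ⟪a, x.snd⟫ = 0
    linarith
  -- In finite dimension this splits `(y, b)`; the `Cᗮ` part has zero second component, so `b`
  -- survives intact.
  have horth : (L ⊓ C)ᗮ = Lᗮ ⊔ Cᗮ := by
    rw [← Submodule.orthogonal_orthogonal (Lᗮ ⊔ Cᗮ), ← Submodule.inf_orthogonal,
      Submodule.orthogonal_orthogonal, Submodule.orthogonal_orthogonal]
  rw [horth, Submodule.mem_sup] at hmem
  obtain ⟨z, hz, w, hw, hzw⟩ := hmem
  obtain ⟨hw₁, hw₂⟩ := mem_orthogonal_comap_fst hw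
  have h₁ : z.fst + w.fst = y := congrArg WithLp.fst hzw
  have h₂ : z.snd + w.snd = b := congrArg WithLp.snd hzw
  refine ⟨z, hz, fun x hx => ?_, fun v hv => ?_⟩
  · rw [← h₁, inner_add_right, hw₁ x hx, add_zero]
  · rw [hw₂, add_zero] at h₂
    rw [h₂, hb, inner_sum]
    refine Finset.sum_nonneg fun a ha => ?_
    rw [real_inner_smul_right, real_inner_comm]
    exact mul_nonneg (hc a) (hv a ha)

end Product

theorem mem_innerDual_euclideanProd {n₁ n₂ : ℕ} (K₁ : ProperCone ℝ (EuclideanSpace ℝ (Fin n₁)))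
    (K₂ : ProperCone ℝ (EuclideanSpace ℝ (Fin n₂)))
    (y : WithLp 2 (EuclideanSpace ℝ (Fin n₁) × EuclideanSpace ℝ (Fin n₂))) :
    y ∈ ProperCone.innerDual (euclideanProd (K₁ : Set (EuclideanSpace ℝ (Fin n₁))) K₂) ↔
      y.fst ∈ ProperCone.innerDual (K₁ : Set (EuclideanSpace ℝ (Fin n₁))) ∧
      y.snd ∈ ProperCone.innerDual (K₂ : Set (EuclideanSpace ℝ (Fin n₂))) := by
  simp only [ProperCone.mem_innerDual]
  constructor
  · intro h
    constructor
    · intro x hx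
      simpa [WithLp.prod_inner_apply] using
        h (show WithLp.toLp 2 (x, 0) ∈ euclideanProd _ _ from ⟨hx, zero_mem K₂⟩)
    · intro x hx
      simpa [WithLp.prod_inner_apply] using
        h (show WithLp.toLp 2 (0, x) ∈ euclideanProd _ _ from ⟨zero_mem K₁, hx⟩)
  · rintro ⟨h₁, h₂⟩ x ⟨hx₁, hx₂⟩
    exact add_nonneg (h₁ hx₁) (h₂ hx₂)

end PartialPolyhedral

theorem mainTheorem4 {n₁ n₂ : ℕ}
    (K₁ : ProperCone ℝ (EuclideanSpace ℝ (Fin n₁)))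
    (K₂ : ProperCone ℝ (EuclideanSpace ℝ (Fin n₂)))
    (hK₂ : PartialPolyhedral.IsPolyhedral K₂)
    (L : Submodule ℝ (WithLp 2 (EuclideanSpace ℝ (Fin n₁) × EuclideanSpace ℝ (Fin n₂)))) :
    (SetLike.coe (ProperCone.innerDual
          (PartialPolyhedral.euclideanProd (SetLike.coe K₁) (SetLike.coe K₂))) ∩ SetLike.coe Lᗮ ⊆
        PartialPolyhedral.euclideanProd
          (SetLike.coe (ProperCone.innerDual (SetLike.coe K₁)).toPointedCone.lineal)
          (SetLike.coe (ProperCone.innerDual (SetLike.coe K₂)))) ↔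
      (PartialPolyhedral.euclideanProd
          (intrinsicInterior ℝ (SetLike.coe K₁)) (SetLike.coe K₂) ∩ SetLike.coe L).Nonempty := by
  constructor
  · intro h
    obtain ⟨A, hA⟩ := hK₂
    by_contra hne
    set M : PointedCone ℝ (EuclideanSpace ℝ (Fin n₁)) :=
      { carrier := {x | ∃ v ∈ K₂, WithLp.toLp 2 (x, v) ∈ L}
        zero_mem' := ⟨0, zero_mem K₂, zero_mem L⟩
        add_mem' := by
          rintro x y ⟨v, hv, hxv⟩ ⟨w, hw, hyw⟩
          exact ⟨v + w, add_mem hv hw, L.add_mem hxv hyw⟩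
        smul_mem' := by
          rintro c x ⟨v, hv, hxv⟩
          exact ⟨c • v, K₂.toPointedCone.smul_mem c.2 hv, L.smul_mem (c : ℝ) hxv⟩ }
    have hdisj : Disjoint (intrinsicInterior ℝ (K₁ : Set (EuclideanSpace ℝ (Fin n₁)))) M :=
      Set.disjoint_left.2 fun x hx ⟨v, hv, hxv⟩ => hne ⟨WithLp.toLp 2 (x, v), ⟨hx, hv⟩, hxv⟩
    obtain ⟨y, hy, ⟨x₀, hx₀, hyx₀⟩, hyM⟩ :=
      PartialPolyhedral.exists_inner_separation_of_disjoint_intrinsicInterior K₁ M hdisj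
    obtain ⟨z, hzL, hz₁, hz₂⟩ := PartialPolyhedral.exists_mem_orthogonal_of_inner_nonpos A
      (Submodule.span ℝ (K₁ : Set (EuclideanSpace ℝ (Fin n₁)))) L y
      (fun x hx hxU hxA => hyM x.fst ⟨x.snd, (hA _).2 hxA, hx⟩ hxU)
    have hz₁' : ∀ x ∈ K₁, ⟪x, z.fst⟫ = ⟪x, y⟫ := fun x hx => hz₁ x (Submodule.subset_span hx)
    have hzK : z ∈ ProperCone.innerDual (PartialPolyhedral.euclideanProd
        (K₁ : Set (EuclideanSpace ℝ (Fin n₁))) K₂) := by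
      rw [PartialPolyhedral.mem_innerDual_euclideanProd, ProperCone.mem_innerDual,
        ProperCone.mem_innerDual]
      exact ⟨fun x hx => (hy x hx).trans_eq (hz₁' x hx).symm,
        fun v hv => hz₂ v ((hA v).1 hv)⟩
    have hneg : -z.fst ∈ ProperCone.innerDual (K₁ : Set (EuclideanSpace ℝ (Fin n₁))) :=
      (PointedCone.mem_lineal.1 (h ⟨hzK, hzL⟩).1).2
    have hle := ProperCone.mem_innerDual.1 hneg hx₀
    rw [inner_neg_right, hz₁' x₀ hx₀] at hle
    exact hyx₀ (le_antisymm (by linarith) (hy x₀ hx₀))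
  · rintro ⟨x, ⟨hx₁, hx₂⟩, hxL⟩ y ⟨hyK, hyL⟩
    obtain ⟨hy₁, hy₂⟩ := (PartialPolyhedral.mem_innerDual_euclideanProd K₁ K₂ y).1 hyK
    refine ⟨PointedCone.mem_lineal.2 ⟨hy₁, ?_⟩, hy₂⟩
    refine ProperCone.mem_innerDual.2 fun z hz => ?_
    obtain ⟨t, ht, hxt⟩ :=
      PartialPolyhedral.exists_pos_sub_smul_mem_of_mem_intrinsicInterior (zero_mem K₁) hx₁ hz
    have h₁ : 0 ≤ ⟪x.fst - t • z, y.fst⟫ := ProperCone.mem_innerDual.1 hy₁ hxt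
    have h₂ : 0 ≤ ⟪x.snd, y.snd⟫ := ProperCone.mem_innerDual.1 hy₂ hx₂
    have h₃ : ⟪x.fst, y.fst⟫ + ⟪x.snd, y.snd⟫ = 0 := hyL x hxL
    rw [inner_sub_left, real_inner_smul_left] at h₁
    rw [inner_neg_right]
    -- By `h₂` and `h₃`, `⟪x.fst, y.fst⟫ ≤ 0`.
    have h₄ : t * ⟪z, y.fst⟫ ≤ 0 := by linarith
    linarith [nonpos_of_mul_nonpos_right h₄ ht]
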